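/- For $\sigma:\mathbf R^2\times\mathbf R^2\to\mathbf R$ bounded and measurable, let $T_\sigma f(x)=\int_{\mathbf R^2}\sigma(x,\xi)e^{2\pi i\xi\cdot x}\hat f(\xi)\,d\xi$ for Schwartz functions $f$, where $\hat f(\xi)=\int f(y)e^{-2\pi i y\cdot\xi}\,dy$, and let $\|T_\sigma\|_{L^2\to L^2}=\sup\{\|T_\sigma f\|_{L^2}: f \text{ Schwartz},\ \|f\|_{L^2}\le 1\}\in[0,\infty]$. The symbol $\sigma$ is called homogeneous of degree zero if $\sigma(x,t\xi)=\sigma(x,\xi)$ for all $x$, all $\xi\neq0$ and all $t>0$. Let $\|h\|_{W^{1,1}(\mathbf S^1)}=\|h\|_{L^1(\mathbf S^1)}+\|\partial_\theta h\|_{L^1(\mathbf S^1)}$, with $\partial_\theta$ the weak angular derivative (the norm is $\infty$ if $h\notin W^{1,1}(\mathbf S^1)$). **Proposition.** Let $\psi\in C^\infty(\mathbf R)$ be such that $-1\le\psi\le1$, $\psi=-1$ on $(-\infty,-1]$ and $\psi=1$ on $[1,\infty)$. There is a constant $C<\infty$, depending only on $\psi$, such that for every $N>1$ there is a measurable, real-valued,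 homogeneous of degree zero symbol $\sigma:\mathbf R^2\times\mathbf R^2\to\mathbf R$ with $$\sup_{x,\xi}|\sigma(x,\xi)|\le 1,\qquad \sup_x\|\sigma(x,\cdot)\|_{W^{1,1}(\mathbf S^1)}\le C,\qquad \|T_\sigma\|_{L^2\to L^2}>N .$$ Moreover, $\sigma$ can be taken to be a smoothed symbol of the linearized maximal directional Hilbert transform, that is, of the form $$\sigma(x,\xi)=\psi\Big(\frac{u(x)\cdot\xi/|\xi|}{\delta}\Big)\qquad(\xi\ne0)$$ for some measurable $u:\mathbf R^2\to\mathbf S^1$ and some $0<\delta<1$. -/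

import Mathlib

open MeasureTheory Set
open scoped ContDiff ENNReal NNReal FourierTransform SchwartzMap

noncomputable section

/-- The Euclidean plane. -/
abbrev Plane : Type := EuclideanSpace ℝ (Fin 2)

/-- The value `T_σ f (x) = ∫ σ(x, ξ) e^{2 π i ξ · x} f̂(ξ) dξ` of the pseudodifferential operator
with symbol `σ`, where `f̂(ξ) = ∫ f(y) e^{- 2 π i y · ξ} dy`. -/
def pdo (σ : Plane → Plane → ℝ) (f : 𝓢(Plane, ℂ)) (x : Plane) : ℂ :=
  ∫ ξ : Plane, (σ x ξ : ℂ) * Complex.exp (2 * Real.pi * Complex.I * (inner ℝ ξ x : ℝ)) *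
    𝓕 (f : Plane → ℂ) ξ

/-- The operator norm of `T_σ` from `L²` to `L²`, computed on the dense class of Schwartz
functions (it is `∞` when `T_σ` has no bounded extension to `L²`). -/
def pdoNorm (σ : Plane → Plane → ℝ) : ℝ≥0∞ :=
  ⨆ (f : 𝓢(Plane, ℂ)) (_ : eLpNorm f 2 volume ≤ 1), eLpNorm (pdo σ f) 2 volume

/-- The symbol `σ` is homogeneous of degree zero in `ξ`, that is, `σ(x, ξ) = q(x, ξ / |ξ|)`. -/
def HomogeneousDegreeZero (σ : Plane → Plane → ℝ) : Prop :=
  ∀ (x ξ : Plane) (t : ℝ), ξ ≠ 0 → 0 < t → σ x (t • ξ) = σ x ξ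

/-- The function on the unit circle given by `f`, in the angular variable. -/
def onCircle (f : Plane → ℝ) (θ : ℝ) : ℝ := f !₂[Real.cos θ, Real.sin θ]

/-- `g` is the weak derivative of `F` on the circle `ℝ / 2πℤ` (both integrable; only their values
on `(0, 2π)` matter). -/
def IsWeakAngularDeriv (F g : ℝ → ℝ) : Prop :=
  IntegrableOn F (Ioo 0 (2 * Real.pi)) ∧ IntegrableOn g (Ioo 0 (2 * Real.pi)) ∧
    ∀ φ : ℝ → ℝ, ContDiff ℝ ∞ φ → Function.Periodic φ (2 * Real.pi) →
      ∫ θ in Ioo 0 (2 * Real.pi), F θ * deriv φ θ = - ∫ θ in Ioo 0 (2 * Real.pi), g θ * φ θ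

/-- The norm of (the restriction of) `f` in `W^{1,1}(S¹)`, namely `‖f‖_{L¹} + ‖∂_θ f‖_{L¹}` with
the weak derivative `∂_θ f`. As the weak derivative is unique almost everywhere, the infimum is over
a single value; it is `∞` when `f` is not in `W^{1,1}(S¹)`. -/
def sobolevOneOneNorm (f : Plane → ℝ) : ℝ≥0∞ :=
  ⨅ (g : ℝ → ℝ) (_ : IsWeakAngularDeriv (onCircle f) g),
    (∫⁻ θ in Ioo 0 (2 * Real.pi), ‖onCircle f θ‖ₑ) + ∫⁻ θ in Ioo 0 (2 * Real.pi), ‖g θ‖ₑ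

/-- `σ(x, ξ) = ψ(u(x) · (ξ / |ξ|) / δ)`, the symbol `sgn(u(x) · ξ)` of the directional Hilbert
transform `H_{u(x)}` along a measurable field `u` of unit vectors (a linearization of
`H_* f = sup_u |H_u f|`), with the sign function replaced by `ψ(· / δ)`. -/
def IsSmoothedDirectionalHilbert (ψ : ℝ → ℝ) (σ : Plane → Plane → ℝ) : Prop :=
  ∃ (u : Plane → Plane) (δ : ℝ), Measurable u ∧ (∀ x, ‖u x‖ = 1) ∧ 0 < δ ∧ δ < 1 ∧
    ∀ x ξ : Plane, ξ ≠ 0 → σ x ξ = ψ (inner ℝ (u x) (‖ξ‖⁻¹ • ξ) / δ)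

end

/-! One field and one function suffice: `u(x) = x/|x|` and `f` the Gaussian `e^{-π|x|²}`, which is
its own Fourier transform. As `δ → 0` the symbol tends to `sgn(u(x)·ξ)`. In coordinates with first
axis along `x` the transverse variable integrates out, and the limit of `T_σ f(x)` is a
one-dimensional Hilbert transform of the Gaussian evaluated at `R = |x|`
(`integral_plane_eq_integral_line`). The jump of the sign at `0` makes this decay only like `1/(πR)`
in modulus (`tendsto_hilbert_gaussian`), and `1/|x|` is not square integrable at infinity in the
plane (`not_memLp_two_of_inv_norm_le`). By Fatou, the operator norms cannot stay below `N` for all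
`δ` in `(0,1)`. On the circle, `σ(x,·)` is a rotation of `ψ(cos θ / δ)`. As `cos` is monotone on two
half-circles, its variation is at most `2∫|ψ'|`, whatever `δ` is (`integral_abs_deriv_comp_cos_le`).
-/

/-! ### The Gaussian: Schwartz class, Fourier transform and `L²` norm. -/

open Filter Topology Real in
theorem exists_one_add_pow_mul_exp_neg_sq_le (m : ℕ) :
    ∃ C : ℝ, ∀ t : ℝ, 0 ≤ t → (1 + t) ^ m * exp (-π * t ^ 2) ≤ C := by
  -- The factorial comes from `w ^ m / m! ≤ e ^ w` at `w = 1 + t`, and `exp 2` from `1 + t - π t² ≤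
  -- 2`.
  refine ⟨m.factorial * exp 2, fun t ht => ?_⟩
  have h1 : (1 + t) ^ m ≤ m.factorial * exp (1 + t) := by
    have := Real.pow_div_factorial_le_exp (1 + t) (by positivity) m
    rwa [div_le_iff₀ (by positivity), mul_comm] at this
  have h2 : exp (1 + t) * exp (-π * t ^ 2) ≤ exp 2 := by
    rw [← exp_add]
    apply exp_le_exp.2
    nlinarith [pi_gt_three, sq_nonneg (t - 1), sq_nonneg t]
  calc (1 + t) ^ m * exp (-π * t ^ 2)
      ≤ (m.factorial * exp (1 + t)) * exp (-π * t ^ 2) := by gcongr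
    _ = m.factorial * (exp (1 + t) * exp (-π * t ^ 2)) := by ring
    _ ≤ _ := by gcongr

theorem contDiff_exp_neg_pi_norm_sq {V : Type*} [NormedAddCommGroup V] [InnerProductSpace ℝ V] :
    ContDiff ℝ ∞ (fun x : V => Real.exp (-Real.pi * ‖x‖ ^ 2)) :=
  (contDiff_const.mul (contDiff_norm_sq ℝ)).exp

/-- The exponent has derivatives of polynomial growth and `exp` is its own derivative, so the bound
for derivatives of a composition leaves a polynomial times the Gaussian. -/
theorem exp_neg_pi_norm_sq_decay {V : Type*} [NormedAddCommGroup V] [InnerProductSpace ℝ V]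
    (k n : ℕ) : ∃ C : ℝ, ∀ x : V,
      ‖x‖ ^ k * ‖iteratedFDeriv ℝ n (fun x : V => Real.exp (-Real.pi * ‖x‖ ^ 2)) x‖ ≤ C := by
  have hq : (fun x : V => -Real.pi * ‖x‖ ^ 2).HasTemperateGrowth := by fun_prop
  obtain ⟨m, A, hA, hbound⟩ := hq.norm_iteratedFDeriv_le_uniform n
  obtain ⟨B, hB⟩ := exists_one_add_pow_mul_exp_neg_sq_le (k + m * n)
  refine ⟨n.factorial * (1 + A) ^ n * B, fun x => ?_⟩
  -- With `1 + A` in place of `A` the base is at least `1`, hence is bounded by its `i`-th power for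
  -- `i ≥ 1`, as the composition bound requires.
  have hD : 1 ≤ (1 + A) * (1 + ‖x‖) ^ m :=
    one_le_mul_of_one_le_of_one_le (by linarith) (one_le_pow₀ (by linarith [norm_nonneg x]))
  have hcomp : ‖iteratedFDeriv ℝ n (Real.exp ∘ fun x : V => -Real.pi * ‖x‖ ^ 2) x‖ ≤
      n.factorial * Real.exp (-Real.pi * ‖x‖ ^ 2) * ((1 + A) * (1 + ‖x‖) ^ m) ^ n := by
    refine norm_iteratedFDeriv_comp_le (N := ∞) Real.contDiff_exp hq.1
      (by exact_mod_cast le_top) x (fun i _ => ?_) (fun i hi hin => ?_)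
    · rw [norm_iteratedFDeriv_eq_norm_iteratedDeriv, iteratedDeriv_eq_iterate,
        Real.iter_deriv_exp, Real.norm_eq_abs, Real.abs_exp]
    · calc _ ≤ A * (1 + ‖x‖) ^ m := hbound i hin x
        _ ≤ (1 + A) * (1 + ‖x‖) ^ m := by gcongr; linarith
        _ ≤ _ := le_self_pow₀ hD (by omega)
  have hx : ‖x‖ ^ k ≤ (1 + ‖x‖) ^ k := by gcongr; linarith
  calc _ ≤ (1 + ‖x‖) ^ k *
        (n.factorial * Real.exp (-Real.pi * ‖x‖ ^ 2) * ((1 + A) * (1 + ‖x‖) ^ m) ^ n) :=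
        mul_le_mul hx hcomp (norm_nonneg _) (by positivity)
    _ = n.factorial * (1 + A) ^ n *
        ((1 + ‖x‖) ^ (k + m * n) * Real.exp (-Real.pi * ‖x‖ ^ 2)) := by
        rw [mul_pow, pow_add, pow_mul]; ring
    _ ≤ _ := by gcongr; exact hB _ (norm_nonneg x)

/-- The Gaussian `e^{-π|x|²}` as a Schwartz function. -/
noncomputable def gaussianSchwartz (V : Type*) [NormedAddCommGroup V] [InnerProductSpace ℝ V] :
    𝓢(V, ℂ) where
  toFun x := (Real.exp (-Real.pi * ‖x‖ ^ 2) : ℂ)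
  smooth' := Complex.ofRealCLM.contDiff.comp contDiff_exp_neg_pi_norm_sq
  decay' k n := by
    obtain ⟨C, hC⟩ := exp_neg_pi_norm_sq_decay (V := V) k n
    refine ⟨C, fun x => ?_⟩
    have h := Complex.ofRealLI.norm_iteratedFDeriv_comp_left (x := x)
      (contDiff_exp_neg_pi_norm_sq (V := V)).contDiffAt (i := n) (by exact_mod_cast le_top)
    exact (congrArg (‖x‖ ^ k * ·) h).trans_le (hC x)

theorem gaussianSchwartz_apply {V : Type*} [NormedAddCommGroup V] [InnerProductSpace ℝ V] (x : V) :
    gaussianSchwartz V x = (Real.exp (-Real.pi * ‖x‖ ^ 2) : ℂ) := rfl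

section

variable {V : Type*} [NormedAddCommGroup V] [InnerProductSpace ℝ V] [FiniteDimensional ℝ V]
  [MeasurableSpace V] [BorelSpace V]

theorem fourier_gaussianSchwartz (ξ : V) :
    𝓕 (gaussianSchwartz V : V → ℂ) ξ = (Real.exp (-Real.pi * ‖ξ‖ ^ 2) : ℂ) := by
  have hπ : (Real.pi : ℂ) ≠ 0 := by exact_mod_cast Real.pi_ne_zero
  have h := fourier_gaussian_innerProductSpace (V := V) (b := Real.pi)
    (by simpa using Real.pi_pos) ξ
  have h2 : (gaussianSchwartz V : V → ℂ) = fun v => Complex.exp (-(Real.pi : ℂ) * ‖v‖ ^ 2) := by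
    ext v; rw [gaussianSchwartz_apply]; push_cast; rfl
  rw [h2, h, div_self hπ, Complex.one_cpow, one_mul]
  push_cast
  congr 1
  field_simp

theorem integrable_exp_neg_pi_norm_sq :
    Integrable (fun x : V => Real.exp (-Real.pi * ‖x‖ ^ 2)) := by
  refine ((gaussianSchwartz V).integrable (μ := volume)).norm.congr (ae_of_all _ fun x => ?_)
  change ‖((Real.exp (-Real.pi * ‖x‖ ^ 2) : ℝ) : ℂ)‖ = _
  rw [Complex.norm_real, Real.norm_eq_abs, Real.abs_exp]

theorem eLpNorm_gaussianSchwartz_le_one : eLpNorm (gaussianSchwartz V) 2 volume ≤ 1 := by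
  have hle : ∀ x : V, ‖gaussianSchwartz V x‖ₑ ^ (2 : ℝ) ≤
      ENNReal.ofReal (Real.exp (-Real.pi * ‖x‖ ^ 2)) := fun x => by
    rw [← ofReal_norm, gaussianSchwartz_apply, Complex.norm_real,
      Real.norm_eq_abs, Real.abs_exp, ENNReal.ofReal_rpow_of_pos (Real.exp_pos _)]
    apply ENNReal.ofReal_le_ofReal
    rw [← Real.exp_mul]
    apply Real.exp_le_exp.2
    nlinarith [Real.pi_pos, mul_nonneg Real.pi_pos.le (sq_nonneg ‖x‖)]
  rw [eLpNorm_eq_lintegral_rpow_enorm_toReal two_ne_zero ENNReal.ofNat_ne_top]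
  refine ENNReal.rpow_le_one ?_ (by positivity)
  refine (lintegral_mono hle).trans ?_
  rw [← ofReal_integral_eq_lintegral_ofReal integrable_exp_neg_pi_norm_sq
    (ae_of_all _ fun x => (Real.exp_pos _).le),
    GaussianFourier.integral_rexp_neg_mul_sq_norm Real.pi_pos, div_self Real.pi_ne_zero,
    Real.one_rpow, ENNReal.ofReal_one]

end

/-! ### The Hilbert transform of the one-dimensional Gaussian at infinity. -/

theorem hasDerivAt_oscillating_gaussian (R s : ℝ) :
    HasDerivAt (fun s : ℝ => Complex.exp (2 * Real.pi * Complex.I * R * s - Real.pi * s ^ 2))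
      ((2 * Real.pi * Complex.I * R - 2 * Real.pi * s) *
        Complex.exp (2 * Real.pi * Complex.I * R * s - Real.pi * s ^ 2)) s := by
  have h1 : HasDerivAt (fun s : ℝ => (s : ℂ)) 1 s := Complex.ofRealCLM.hasDerivAt
  have h := ((h1.const_mul (2 * Real.pi * Complex.I * R)).sub
    ((h1.pow 2).const_mul (Real.pi : ℂ))).cexp
  refine h.congr_deriv ?_
  simp only [Pi.sub_apply, Pi.pow_apply]
  norm_num
  ring

theorem norm_oscillating_gaussian (R s : ℝ) :
    ‖Complex.exp (2 * Real.pi * Complex.I * R * s - Real.pi * s ^ 2)‖ =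
      Real.exp (-Real.pi * s ^ 2) := by
  rw [Complex.norm_exp]
  congr 1
  simp [← Complex.ofReal_pow]

theorem tendsto_oscillating_gaussian (R : ℝ) :
    Filter.Tendsto
      (fun s : ℝ => Complex.exp (2 * Real.pi * Complex.I * R * s - Real.pi * s ^ 2))
      (Filter.cocompact ℝ) (nhds 0) := by
  rw [tendsto_zero_iff_norm_tendsto_zero]
  simp_rw [norm_oscillating_gaussian]
  have h := tendsto_rpow_abs_mul_exp_neg_mul_sq_cocompact Real.pi_pos 0
  simpa using h

theorem integrable_mul_oscillating_gaussian (R : ℝ) :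
    Integrable (fun s : ℝ => (s : ℂ) *
      Complex.exp (2 * Real.pi * Complex.I * R * s - Real.pi * s ^ 2)) := by
  refine (integrable_mul_exp_neg_mul_sq Real.pi_pos).mono
    (by fun_prop) (ae_of_all _ fun s => ?_)
  rw [norm_mul, norm_oscillating_gaussian, Complex.norm_real,
    norm_mul, Real.norm_eq_abs (Real.exp _), Real.abs_exp]

theorem integrable_oscillating_gaussian (R : ℝ) :
    Integrable (fun s : ℝ =>
      Complex.exp (2 * Real.pi * Complex.I * R * s - Real.pi * s ^ 2)) := by
  refine (integrable_exp_neg_mul_sq Real.pi_pos).mono (by fun_prop) (ae_of_all _ fun s => ?_)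
  rw [norm_oscillating_gaussian, Real.norm_eq_abs, Real.abs_exp]

section

variable {S : ℝ → ℝ}

theorem integral_sign_mul (hpos : ∀ s, 0 < s → S s = 1)
    (hneg : ∀ s, s < 0 → S s = -1) {f : ℝ → ℂ} (hf : Integrable f) :
    Integrable (fun s => (S s : ℂ) * f s) ∧
      ∫ s, (S s : ℂ) * f s = (∫ s in Ioi 0, f s) - ∫ s in Iic 0, f s := by
  have hp : EqOn (fun s => (S s : ℂ) * f s) f (Ioi 0) := fun s hs => by simp [hpos s hs]
  have hn : EqOn (fun s => (S s : ℂ) * f s) (fun s => - f s) (Iio 0) :=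
    fun s hs => by simp [hneg s hs]
  have ip : IntegrableOn (fun s => (S s : ℂ) * f s) (Ioi 0) :=
    (integrableOn_congr_fun hp measurableSet_Ioi).2 hf.integrableOn
  have ineg : IntegrableOn (fun s => (S s : ℂ) * f s) (Iic 0) :=
    (integrableOn_Iic_iff_integrableOn_Iio enorm_ne_top).2
      ((integrableOn_congr_fun hn measurableSet_Iio).2 hf.neg.integrableOn)
  have hint : Integrable (fun s => (S s : ℂ) * f s) := by
    rw [← integrableOn_univ, ← Iic_union_Ioi (a := (0 : ℝ))]
    exact ineg.union ip
  refine ⟨hint, ?_⟩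
  rw [← intervalIntegral.integral_Iic_add_Ioi ineg ip, setIntegral_congr_fun measurableSet_Ioi hp,
    integral_Iic_eq_integral_Iio, setIntegral_congr_fun measurableSet_Iio hn, integral_neg,
    integral_Iic_eq_integral_Iio]
  ring

/-- This is integration by parts: the derivative of the oscillating Gaussian is integrated over each
half-line. Both boundary terms at `0` contribute `-1` because `S` jumps there, whence the `-2`. -/
theorem hilbert_gaussian_identity (hpos : ∀ s, 0 < s → S s = 1)
    (hneg : ∀ s, s < 0 → S s = -1) (R : ℝ) :
    2 * Real.pi * Complex.I * R *
      ∫ s : ℝ, (S s : ℂ) * Complex.exp (2 * Real.pi * Complex.I * R * s - Real.pi * s ^ 2) =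
    -2 + ∫ s : ℝ, (S s : ℂ) * (2 * Real.pi * (s *
      Complex.exp (2 * Real.pi * Complex.I * R * s - Real.pi * s ^ 2))) := by
  have i0 := integrable_oscillating_gaussian R
  have i1 := integrable_mul_oscillating_gaussian R
  have i2 : Integrable (fun s : ℝ => (2 * Real.pi * Complex.I * R - 2 * Real.pi * s) *
      Complex.exp (2 * Real.pi * Complex.I * R * s - Real.pi * s ^ 2)) := by
    refine ((i0.const_mul (2 * Real.pi * Complex.I * R)).sub
      (i1.const_mul (2 * Real.pi))).congr (ae_of_all _ fun s => ?_)
    simp only [Pi.sub_apply]; ring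
  have hlim := tendsto_oscillating_gaussian R
  have hp := integral_Ioi_of_hasDerivAt_of_tendsto' (a := 0)
    (fun s _ => hasDerivAt_oscillating_gaussian R s) i2.integrableOn
    (hlim.mono_left atTop_le_cocompact)
  have hn := integral_Iic_of_hasDerivAt_of_tendsto' (a := 0)
    (fun s _ => hasDerivAt_oscillating_gaussian R s) i2.integrableOn
    (hlim.mono_left atBot_le_cocompact)
  have h2 := (integral_sign_mul hpos hneg i2).2
  rw [hp, hn] at h2
  have j0 := (integral_sign_mul hpos hneg i0).1
  have j1 := (integral_sign_mul hpos hneg (i1.const_mul (2 * Real.pi))).1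
  have hsub : ∫ s : ℝ, (S s : ℂ) * ((2 * Real.pi * Complex.I * R - 2 * Real.pi * s) *
      Complex.exp (2 * Real.pi * Complex.I * R * s - Real.pi * s ^ 2)) =
      (∫ s : ℝ, 2 * Real.pi * Complex.I * R * ((S s : ℂ) *
        Complex.exp (2 * Real.pi * Complex.I * R * s - Real.pi * s ^ 2))) -
      ∫ s : ℝ, (S s : ℂ) * (2 * Real.pi * (s *
        Complex.exp (2 * Real.pi * Complex.I * R * s - Real.pi * s ^ 2))) := by
    rw [← integral_sub (j0.const_mul _) j1]
    congr 1; ext s; ring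
  rw [hsub, integral_const_mul] at h2
  rw [sub_eq_iff_eq_add] at h2
  rw [h2]
  norm_num

/-- The integral left over by the integration by parts vanishes in the limit by the Riemann–Lebesgue
lemma, used at frequency `-R`. -/
theorem tendsto_hilbert_gaussian (hpos : ∀ s, 0 < s → S s = 1)
    (hneg : ∀ s, s < 0 → S s = -1) :
    Filter.Tendsto (fun R : ℝ => 2 * Real.pi * Complex.I * R *
      ∫ s : ℝ, (S s : ℂ) * Complex.exp (2 * Real.pi * Complex.I * R * s - Real.pi * s ^ 2))
      Filter.atTop (nhds (-2)) := by
  simp_rw [hilbert_gaussian_identity hpos hneg]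
  have h := (Real.tendsto_integral_exp_smul_cocompact (fun s : ℝ => (S s : ℂ) *
    (2 * Real.pi * (s * Complex.exp (-Real.pi * s ^ 2))))).comp
    (Filter.tendsto_neg_atTop_atBot.mono_right atBot_le_cocompact)
  have h3 := h.const_add (-2 : ℂ)
  rw [add_zero] at h3
  refine h3.congr fun R => ?_
  simp only [Function.comp]
  congr 1
  apply integral_congr_ae (ae_of_all _ fun s => ?_)
  simp only [Circle.smul_def, Real.fourierChar_apply, smul_eq_mul]
  have : Complex.exp (2 * Real.pi * Complex.I * R * s - Real.pi * s ^ 2) =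
      Complex.exp (((2 * Real.pi * -(s * -R) : ℝ) : ℂ) * Complex.I) *
        Complex.exp (-Real.pi * s ^ 2) := by
    rw [← Complex.exp_add]; congr 1; push_cast; ring
  rw [this]
  ring

theorem exists_norm_hilbert_gaussian_ge (hpos : ∀ s, 0 < s → S s = 1)
    (hneg : ∀ s, s < 0 → S s = -1) :
    ∃ R₀ : ℝ, 1 ≤ R₀ ∧ ∀ R : ℝ, R₀ ≤ R → 1 / (2 * Real.pi * R) ≤
      ‖∫ s : ℝ, (S s : ℂ) * Complex.exp (2 * Real.pi * Complex.I * R * s - Real.pi * s ^ 2)‖ := by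
  -- Any constant in `(0, 2)` would serve as well as `1`.
  have h := (tendsto_hilbert_gaussian hpos hneg).norm.eventually
    (eventually_ge_nhds (show (1 : ℝ) < ‖(-2 : ℂ)‖ by norm_num))
  obtain ⟨R₁, hR₁⟩ := Filter.eventually_atTop.1 h
  refine ⟨max 1 R₁, le_max_left _ _, fun R hR => ?_⟩
  have hRpos : 0 < R := lt_of_lt_of_le one_pos ((le_max_left _ _).trans hR)
  have h1 := hR₁ R ((le_max_right _ _).trans hR)
  rw [norm_mul] at h1
  have h2 : ‖(2 * Real.pi * Complex.I * R : ℂ)‖ = 2 * Real.pi * R := by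
    simp [abs_of_pos Real.pi_pos, abs_of_pos hRpos]
  rw [h2] at h1
  rw [div_le_iff₀ (by positivity)]
  linarith

end

/-! ### The radial field, its smoothed symbols and their pointwise limit. -/

/-- The radial unit vector field of the plane, with an arbitrary value at the origin. -/
noncomputable def radialField (x : Plane) : Plane :=
  if x = 0 then EuclideanSpace.single 0 1 else ‖x‖⁻¹ • x

theorem measurable_radialField : Measurable radialField :=
  Measurable.ite (measurableSet_singleton 0) measurable_const (by fun_prop)

theorem norm_radialField (x : Plane) : ‖radialField x‖ = 1 := by
  unfold radialField
  split_ifs with h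
  · simp
  · rw [norm_smul, norm_inv, norm_norm, inv_mul_cancel₀ (norm_ne_zero_iff.2 h)]

/-- The symbol of the smoothed directional Hilbert transform along the field `u`. -/
noncomputable def smoothedSymbol (ψ : ℝ → ℝ) (u : Plane → Plane) (δ : ℝ) (x ξ : Plane) : ℝ :=
  ψ (inner ℝ (u x) (‖ξ‖⁻¹ • ξ) / δ)

theorem measurable_uncurry_smoothedSymbol {ψ : ℝ → ℝ} (hψ : Measurable ψ) {u : Plane → Plane}
    (hu : Measurable u) (δ : ℝ) : Measurable (Function.uncurry (smoothedSymbol ψ u δ)) := by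
  have h1 : Measurable fun p : Plane × Plane => u p.1 := hu.comp measurable_fst
  have h2 : Measurable fun p : Plane × Plane => ‖p.2‖⁻¹ • p.2 := by fun_prop
  exact hψ.comp ((h1.inner h2).div_const δ)

theorem homogeneousDegreeZero_smoothedSymbol (ψ : ℝ → ℝ) (u : Plane → Plane) (δ : ℝ) :
    HomogeneousDegreeZero (smoothedSymbol ψ u δ) := by
  intro x ξ t _ ht
  unfold smoothedSymbol
  rw [norm_smul, Real.norm_of_nonneg ht.le, smul_smul, mul_inv, mul_right_comm,
    inv_mul_cancel₀ ht.ne', one_mul]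

/-- The function `sgn`, with the value `c` at the origin. -/
noncomputable def signWithValue (c t : ℝ) : ℝ := if 0 < t then 1 else if t < 0 then -1 else c

theorem signWithValue_mul {c a : ℝ} (ha : 0 < a) (t : ℝ) :
    signWithValue c (a * t) = signWithValue c t := by
  simp only [signWithValue, mul_pos_iff_of_pos_left ha, mul_neg_iff, ha, not_lt_of_gt ha,
    true_and, false_and, or_false]

/-- For `t ≠ 0` the sequence is eventually constant. The value `ψ 0` at the origin makes the limit
hold everywhere, so that no null set has to be discarded. -/
theorem tendsto_dilate_signWithValue {ψ : ℝ → ℝ} (hneg : ∀ z, z ≤ -1 → ψ z = -1)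
    (hpos : ∀ z, 1 ≤ z → ψ z = 1) {δ : ℕ → ℝ} (hδ : Filter.Tendsto δ Filter.atTop (nhds 0))
    (hδ0 : ∀ n, 0 < δ n) (t : ℝ) :
    Filter.Tendsto (fun n => ψ (t / δ n)) Filter.atTop (nhds (signWithValue (ψ 0) t)) := by
  unfold signWithValue
  rcases lt_trichotomy t 0 with h | rfl | h
  · rw [if_neg h.le.not_gt, if_pos h]
    refine tendsto_const_nhds.congr' ?_
    filter_upwards [hδ.eventually (eventually_le_nhds (neg_pos.2 h))] with n hn
    rw [hneg]
    rw [div_le_iff₀ (hδ0 n)]; linarith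
  · simp
  · rw [if_pos h]
    refine tendsto_const_nhds.congr' ?_
    filter_upwards [hδ.eventually (eventually_le_nhds h)] with n hn
    rw [hpos]
    rw [le_div_iff₀ (hδ0 n)]; linarith

/-! ### Reduction to the line and failure of square integrability. -/

theorem exists_orthonormalBasis_apply_zero_eq {e : Plane} (he : ‖e‖ = 1) :
    ∃ b : OrthonormalBasis (Fin 2) ℝ Plane, b 0 = e := by
  have hv : Orthonormal ℝ (({0} : Set (Fin 2)).domRestrict fun _ => e) := by
    refine ⟨fun i => he, fun i j hij => (hij (Subsingleton.elim i j)).elim⟩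
  obtain ⟨b, hb⟩ := hv.exists_orthonormalBasis_extension_of_card_eq (by simp)
  exact ⟨b, hb 0 rfl⟩

/-- In an orthonormal basis whose first vector is `x/|x|`, the integrand is a product of functions
of one coordinate, and the transverse Gaussian has integral `1`. -/
theorem integral_plane_eq_integral_line (S : ℝ → ℝ) {x : Plane} (hx : x ≠ 0) :
    ∫ ξ : Plane, (S (inner ℝ (‖x‖⁻¹ • x) ξ) : ℂ) *
        Complex.exp (2 * Real.pi * Complex.I * (inner ℝ ξ x : ℝ)) *
          (Real.exp (-Real.pi * ‖ξ‖ ^ 2) : ℂ) =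
      ∫ s : ℝ, (S s : ℂ) * Complex.exp (2 * Real.pi * Complex.I * ‖x‖ * s - Real.pi * s ^ 2) := by
  have hx0 : ‖x‖ ≠ 0 := norm_ne_zero_iff.2 hx
  obtain ⟨b, hb⟩ := exists_orthonormalBasis_apply_zero_eq (e := ‖x‖⁻¹ • x)
    (by rw [norm_smul, norm_inv, norm_norm, inv_mul_cancel₀ hx0])
  let f : Fin 2 → ℝ → ℂ := ![fun s => (S s : ℂ) *
    Complex.exp (2 * Real.pi * Complex.I * ‖x‖ * s - Real.pi * s ^ 2),
    fun t => (Real.exp (-Real.pi * t ^ 2) : ℂ)]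
  have hf1 : ∫ t, f 1 t = 1 := by
    change ∫ t : ℝ, ((Real.exp (-Real.pi * t ^ 2) : ℝ) : ℂ) = 1
    rw [integral_complex_ofReal, integral_gaussian, div_self Real.pi_ne_zero]
    simp
  have hprod := integral_fintype_prod_volume_eq_prod f
  rw [Fin.prod_univ_two, hf1, mul_one] at hprod
  change _ = ∫ s, f 0 s
  rw [← hprod, ← b.measurePreserving_repr_symm.integral_comp
      b.repr.symm.toHomeomorph.measurableEmbedding,
    ← (PiLp.volume_preserving_toLp (Fin 2)).integral_comp
      (MeasurableEquiv.toLp 2 (Fin 2 → ℝ)).measurableEmbedding]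
  congr 1
  ext y
  set ξ : Plane := b.repr.symm (WithLp.toLp 2 y) with hξ
  have h0 : inner ℝ (‖x‖⁻¹ • x) ξ = y 0 := by
    rw [← hb, ← b.repr_apply_apply, hξ, LinearIsometryEquiv.apply_symm_apply]
  have h1 : inner ℝ ξ x = ‖x‖ * y 0 := by
    rw [← h0, real_inner_smul_left, real_inner_comm, mul_inv_cancel_left₀ hx0]
  have h2 : ‖ξ‖ ^ 2 = y 0 ^ 2 + y 1 ^ 2 := by
    rw [hξ, LinearIsometryEquiv.norm_map, EuclideanSpace.norm_sq_eq]
    simp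
  rw [h0, h1, h2, Fin.prod_univ_two]
  change _ = (S (y 0) : ℂ) * Complex.exp (2 * Real.pi * Complex.I * ‖x‖ * y 0 -
    Real.pi * y 0 ^ 2) * (Real.exp (-Real.pi * y 1 ^ 2) : ℂ)
  push_cast
  simp only [mul_assoc (S (y 0) : ℂ), ← Complex.exp_add]
  congr 2
  ring

/-- In polar coordinates the lower bound for `|F|²` becomes a multiple of `∫ r⁻² r dr = ∫ dr / r`,
which diverges at infinity. -/
theorem not_memLp_two_of_inv_norm_le {F : Plane → ℂ} {c R₀ : ℝ} (hc : 0 < c) (hR₀ : 0 < R₀)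
    (hF : ∀ x, R₀ ≤ ‖x‖ → c / ‖x‖ ≤ ‖F x‖) : ¬ MemLp F 2 volume := by
  intro h
  have hint : Integrable fun x => ‖F x‖ ^ 2 := by
    simpa using h.integrable_norm_pow two_ne_zero
  let w : ℝ → ℝ := (Ici R₀).indicator fun t => (c / t) ^ 2
  have hw : Measurable w := (by fun_prop : Measurable fun t : ℝ => (c / t) ^ 2).indicator
    measurableSet_Ici
  have h1 : Integrable fun x : Plane => w ‖x‖ := by
    refine hint.mono (hw.comp measurable_norm).aestronglyMeasurable (ae_of_all _ fun x => ?_)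
    by_cases hx : R₀ ≤ ‖x‖
    · have h0 : 0 ≤ c / ‖x‖ := by positivity
      simp only [w, indicator_of_mem (mem_Ici.2 hx), norm_pow, norm_norm, Real.norm_of_nonneg h0]
      gcongr
      exact hF x hx
    · simp [w, indicator_of_notMem (mt mem_Ici.1 hx)]
  rw [integrable_fun_norm_addHaar] at h1
  have h2 := (h1.mono_set (Ioi_subset_Ioi hR₀.le)).const_mul (c ^ 2)⁻¹
  refine not_integrableOn_Ioi_inv ((integrableOn_congr_fun (fun t ht => ?_) measurableSet_Ioi).1 h2)
  have ht' : R₀ < t := ht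
  have ht0 : t ≠ 0 := (hR₀.trans ht').ne'
  simp only [w, indicator_of_mem (mem_Ici.2 ht'.le), finrank_euclideanSpace_fin, smul_eq_mul,
    Nat.reduceSub, pow_one]
  field_simp

/-- The directional Hilbert transform along the radial field of the Gaussian, up to a factor. -/
noncomputable def radialHilbertGaussian (c : ℝ) (x : Plane) : ℂ :=
  ∫ ξ : Plane, (signWithValue c (inner ℝ (radialField x) (‖ξ‖⁻¹ • ξ)) : ℂ) *
    Complex.exp (2 * Real.pi * Complex.I * (inner ℝ ξ x : ℝ)) *
      (Real.exp (-Real.pi * ‖ξ‖ ^ 2) : ℂ)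

theorem radialHilbertGaussian_eq (c : ℝ) {x : Plane} (hx : x ≠ 0) :
    radialHilbertGaussian c x = ∫ s : ℝ, (signWithValue c s : ℂ) *
      Complex.exp (2 * Real.pi * Complex.I * ‖x‖ * s - Real.pi * s ^ 2) := by
  rw [← integral_plane_eq_integral_line _ hx]
  unfold radialHilbertGaussian radialField
  congr 1
  ext ξ
  rw [if_neg hx]
  rcases eq_or_ne ξ 0 with rfl | hξ
  · simp
  -- The sign ignores positive factors, so the normalization of `ξ` drops out.
  · rw [real_inner_smul_right, signWithValue_mul (inv_pos.2 (norm_pos_iff.2 hξ))]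

theorem not_memLp_radialHilbertGaussian (c : ℝ) :
    ¬ MemLp (radialHilbertGaussian c) 2 volume := by
  obtain ⟨R₀, hR₀, h⟩ := exists_norm_hilbert_gaussian_ge (S := signWithValue c)
    (fun s hs => if_pos hs) (fun s hs => by simp [signWithValue, hs, hs.le.not_gt])
  refine not_memLp_two_of_inv_norm_le (c := 1 / (2 * Real.pi)) (by positivity)
    (one_pos.trans_le hR₀) fun x hx => ?_
  rw [radialHilbertGaussian_eq c (norm_pos_iff.1 (by linarith)), div_div]
  exact h _ hx

/-! ### Unboundedness of the operator norms as `δ → 0`. -/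

theorem pdo_gaussianSchwartz (σ : Plane → Plane → ℝ) (x : Plane) :
    pdo σ (gaussianSchwartz Plane) x = ∫ ξ : Plane, (σ x ξ : ℂ) *
      Complex.exp (2 * Real.pi * Complex.I * (inner ℝ ξ x : ℝ)) *
        (Real.exp (-Real.pi * ‖ξ‖ ^ 2) : ℂ) := by
  unfold pdo
  simp_rw [fourier_gaussianSchwartz]

theorem stronglyMeasurable_pdo_gaussianSchwartz {σ : Plane → Plane → ℝ}
    (hσ : Measurable (Function.uncurry σ)) :
    StronglyMeasurable (pdo σ (gaussianSchwartz Plane)) := by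
  have h : pdo σ (gaussianSchwartz Plane) = _ := funext (pdo_gaussianSchwartz σ)
  rw [h]
  apply StronglyMeasurable.integral_prod_right
  apply Measurable.stronglyMeasurable
  have h1 : Measurable fun p : Plane × Plane => (σ p.1 p.2 : ℂ) :=
    Complex.measurable_ofReal.comp hσ
  have h2 : Measurable fun p : Plane × Plane =>
      Complex.exp (2 * Real.pi * Complex.I * (inner ℝ p.2 p.1 : ℝ)) *
        (Real.exp (-Real.pi * ‖p.2‖ ^ 2) : ℂ) := by fun_prop
  convert h1.mul h2 using 1
  ext p
  exact mul_assoc _ _ _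

theorem tendsto_pdo_gaussianSchwartz {σ : ℕ → Plane → Plane → ℝ}
    (hσ : ∀ n, Measurable (Function.uncurry (σ n))) (hbdd : ∀ n x ξ, |σ n x ξ| ≤ 1)
    {x : Plane} {τ : Plane → ℝ}
    (hlim : ∀ ξ, Filter.Tendsto (fun n => σ n x ξ) Filter.atTop (nhds (τ ξ))) :
    Filter.Tendsto (fun n => pdo (σ n) (gaussianSchwartz Plane) x) Filter.atTop
      (nhds (∫ ξ : Plane, (τ ξ : ℂ) *
        Complex.exp (2 * Real.pi * Complex.I * (inner ℝ ξ x : ℝ)) *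
          (Real.exp (-Real.pi * ‖ξ‖ ^ 2) : ℂ))) := by
  simp_rw [pdo_gaussianSchwartz]
  refine tendsto_integral_of_dominated_convergence _ (fun n => ?_)
    integrable_exp_neg_pi_norm_sq (fun n => ae_of_all _ fun ξ => ?_)
    (ae_of_all _ fun ξ => ?_)
  · have h1 : Measurable fun ξ : Plane => (σ n x ξ : ℂ) :=
      Complex.measurable_ofReal.comp ((hσ n).comp measurable_prodMk_left)
    exact ((h1.mul (by fun_prop)).mul (by fun_prop)).aestronglyMeasurable
  · have h2 : ‖Complex.exp (2 * Real.pi * Complex.I * (inner ℝ ξ x : ℝ))‖ = 1 := by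
      rw [show 2 * Real.pi * Complex.I * (inner ℝ ξ x : ℝ) =
        ((2 * Real.pi * inner ℝ ξ x : ℝ) : ℂ) * Complex.I by push_cast; ring]
      exact Complex.norm_exp_ofReal_mul_I _
    rw [norm_mul, norm_mul, h2, mul_one, Complex.norm_real, Complex.norm_real,
      Real.norm_of_nonneg (Real.exp_pos _).le, Real.norm_eq_abs]
    exact mul_le_of_le_one_left (Real.exp_pos _).le (hbdd n x ξ)
  · exact ((Complex.continuous_ofReal.continuousAt.tendsto.comp (hlim ξ)).mul_const _).mul_const _

/-- A bound by `N` for every `δ` would pass to the pointwise limit by Fatou and put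
`radialHilbertGaussian` in `L²`. -/
theorem exists_lt_pdoNorm_smoothedSymbol {ψ : ℝ → ℝ} (hψ : Continuous ψ)
    (hψ_bdd : ∀ z, |ψ z| ≤ 1) (hneg : ∀ z, z ≤ -1 → ψ z = -1) (hpos : ∀ z, 1 ≤ z → ψ z = 1)
    (N : ℝ) : ∃ δ : ℝ, 0 < δ ∧ δ < 1 ∧
      ENNReal.ofReal N < pdoNorm (smoothedSymbol ψ radialField δ) := by
  by_contra! hcon
  -- The shift by `2` gives `δ n < 1` already at `n = 0`.
  let δ : ℕ → ℝ := fun n => 1 / ((n : ℝ) + 2)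
  have hδ0 : ∀ n, 0 < δ n := fun n => by positivity
  have hδ1 : ∀ n, δ n < 1 := fun n => by
    simp only [δ]
    rw [div_lt_one (by positivity)]
    linarith [(Nat.cast_nonneg n : (0 : ℝ) ≤ n)]
  have hδ : Filter.Tendsto δ Filter.atTop (nhds 0) := by
    have h := (tendsto_one_div_add_atTop_nhds_zero_nat (𝕜 := ℝ)).comp (Filter.tendsto_add_atTop_nat 1)
    refine h.congr fun n => ?_
    simp only [Function.comp, δ]
    push_cast
    ring
  have hσ := fun n => measurable_uncurry_smoothedSymbol hψ.measurable measurable_radialField (δ n)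
  have hmeas := fun n => (stronglyMeasurable_pdo_gaussianSchwartz (hσ n)).aestronglyMeasurable
    (μ := volume)
  have hlim : ∀ x, Filter.Tendsto
      (fun n => pdo (smoothedSymbol ψ radialField (δ n)) (gaussianSchwartz Plane) x)
      Filter.atTop (nhds (radialHilbertGaussian (ψ 0) x)) := fun x =>
    tendsto_pdo_gaussianSchwartz hσ (fun n x ξ => hψ_bdd _)
      (fun ξ => tendsto_dilate_signWithValue hneg hpos hδ hδ0 _)
  have hle : ∀ n, eLpNorm (pdo (smoothedSymbol ψ radialField (δ n)) (gaussianSchwartz Plane))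
      2 volume ≤ ENNReal.ofReal N := fun n =>
    (le_iSup₂ (f := fun (f : 𝓢(Plane, ℂ)) (_ : eLpNorm f 2 volume ≤ 1) =>
      eLpNorm (pdo (smoothedSymbol ψ radialField (δ n)) f) 2 volume)
      (gaussianSchwartz Plane) eLpNorm_gaussianSchwartz_le_one).trans
      (hcon (δ n) (hδ0 n) (hδ1 n))
  have hfatou := Lp.eLpNorm_lim_le_liminf_eLpNorm hmeas _ (ae_of_all volume hlim) (p := 2)
  refine not_memLp_radialHilbertGaussian (ψ 0)
    ⟨aestronglyMeasurable_of_tendsto_ae Filter.atTop hmeas (ae_of_all volume hlim),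
      (hfatou.trans (c := ENNReal.ofReal N) ?_).trans_lt ENNReal.ofReal_lt_top⟩
  exact (Filter.liminf_le_liminf (Filter.Eventually.of_forall hle)).trans (by simp)

/-! ### The `W^{1,1}` bound, uniform in `δ`. -/

theorem deriv_eq_zero_of_one_lt_abs {ψ : ℝ → ℝ} (hneg : ∀ z, z ≤ -1 → ψ z = -1)
    (hpos : ∀ z, 1 ≤ z → ψ z = 1) {z : ℝ} (hz : 1 < |z|) : deriv ψ z = 0 := by
  rcases lt_abs.1 hz with h | h
  · have : ψ =ᶠ[nhds z] fun _ => 1 := by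
      filter_upwards [lt_mem_nhds h] with y hy using hpos y hy.le
    rw [this.deriv_eq, deriv_const]
  · have : ψ =ᶠ[nhds z] fun _ => -1 := by
      filter_upwards [gt_mem_nhds (show z < -1 by linarith)] with y hy using hneg y hy.le
    rw [this.deriv_eq, deriv_const]

theorem integrable_abs_deriv_of_eq_const {ψ : ℝ → ℝ} (hψ : ContDiff ℝ 1 ψ)
    (hneg : ∀ z, z ≤ -1 → ψ z = -1) (hpos : ∀ z, 1 ≤ z → ψ z = 1) :
    Integrable fun z => |deriv ψ z| := by
  refine (hψ.continuous_deriv_one.abs).integrable_of_hasCompactSupport ?_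
  refine HasCompactSupport.intro (isCompact_Icc (a := (-1 : ℝ)) (b := 1)) fun z hz => ?_
  have h1 : 1 < |z| := by
    by_contra h
    exact hz (abs_le.1 (not_lt.1 h))
  rw [deriv_eq_zero_of_one_lt_abs hneg hpos h1, abs_zero]

/-- Over an interval on which `m` is monotone or antitone, the variation of `ψ ∘ m` is at most the
total variation of `ψ`. -/
theorem abs_integral_abs_deriv_comp_mul_deriv_le {ψ : ℝ → ℝ} (hψ : ContDiff ℝ 1 ψ)
    (hint : Integrable fun z => |deriv ψ z|) {m m' : ℝ → ℝ} (hm : ∀ θ, HasDerivAt m (m' θ) θ)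
    (hm' : Continuous m') (a b : ℝ) :
    |∫ θ in a..b, |deriv ψ (m θ)| * m' θ| ≤ ∫ z, |deriv ψ z| := by
  have h := intervalIntegral.integral_comp_mul_deriv (a := a) (b := b)
    (fun θ _ => hm θ) hm'.continuousOn hψ.continuous_deriv_one.abs
  simp only [Function.comp_def] at h
  rw [h]
  calc |∫ z in m a..m b, (|deriv ψ z|)| ≤ ∫ z in uIoc (m a) (m b), ‖|deriv ψ z|‖ :=
        (Real.norm_eq_abs _).ge.trans intervalIntegral.norm_integral_le_integral_norm_uIoc
    _ = ∫ z in uIoc (m a) (m b), |deriv ψ z| := by simp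
    _ ≤ ∫ z, |deriv ψ z| := setIntegral_le_integral hint (ae_of_all _ fun z => abs_nonneg _)

/-- The derivative of `cos θ / δ` has constant sign on `[0, π]` and on `[π, 2π]`. On each, the
substitution `z = cos θ / δ` absorbs the factor `1/δ` and costs at most `∫|ψ'|`. -/
theorem integral_abs_deriv_comp_cos_le {ψ : ℝ → ℝ} (hψ : ContDiff ℝ 1 ψ)
    (hint : Integrable fun z => |deriv ψ z|) (δ : ℝ) (hδ : 0 < δ) :
    ∫ θ in 0..2 * Real.pi, |deriv ψ (Real.cos θ / δ) * (-Real.sin θ / δ)| ≤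
      2 * ∫ z, |deriv ψ z| := by
  have hm : ∀ θ, HasDerivAt (fun θ => Real.cos θ / δ) (-Real.sin θ / δ) θ := fun θ =>
    (Real.hasDerivAt_cos θ).div_const δ
  have hm' : Continuous fun θ => -Real.sin θ / δ := by fun_prop
  have hcont : Continuous fun θ => |deriv ψ (Real.cos θ / δ) * (-Real.sin θ / δ)| :=
    ((hψ.continuous_deriv_one.comp (by fun_prop)).mul hm').abs
  have hA := abs_integral_abs_deriv_comp_mul_deriv_le hψ hint hm hm' 0 Real.pi
  have hB := abs_integral_abs_deriv_comp_mul_deriv_le hψ hint hm hm' Real.pi (2 * Real.pi)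
  have h1 : ∫ θ in 0..Real.pi, |deriv ψ (Real.cos θ / δ) * (-Real.sin θ / δ)| =
      -∫ θ in 0..Real.pi, |deriv ψ (Real.cos θ / δ)| * (-Real.sin θ / δ) := by
    rw [← intervalIntegral.integral_neg]
    refine intervalIntegral.integral_congr fun θ hθ => ?_
    rw [uIcc_of_le Real.pi_pos.le] at hθ
    have : 0 ≤ Real.sin θ := Real.sin_nonneg_of_nonneg_of_le_pi hθ.1 hθ.2
    simp only [abs_mul]
    rw [neg_div, abs_neg, abs_of_nonneg (div_nonneg this hδ.le)]
    ring
  have h2 : ∫ θ in Real.pi..2 * Real.pi, |deriv ψ (Real.cos θ / δ) * (-Real.sin θ / δ)| =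
      ∫ θ in Real.pi..2 * Real.pi, |deriv ψ (Real.cos θ / δ)| * (-Real.sin θ / δ) := by
    refine intervalIntegral.integral_congr fun θ hθ => ?_
    rw [uIcc_of_le (by linarith [Real.pi_pos])] at hθ
    have h3 : 0 ≤ -Real.sin θ := by
      have := Real.sin_nonneg_of_nonneg_of_le_pi (x := θ - Real.pi) (by linarith [hθ.1])
        (by linarith [hθ.2])
      rwa [Real.sin_sub_pi] at this
    simp only [abs_mul]
    rw [abs_of_nonneg (div_nonneg h3 hδ.le)]
  rw [← intervalIntegral.integral_add_adjacent_intervals (b := Real.pi)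
    (hcont.intervalIntegrable _ _) (hcont.intervalIntegrable _ _), h1, h2]
  linarith [(abs_le.1 hA).1, (abs_le.1 hB).2]

theorem exists_eq_cos_sin {v : Plane} (hv : ‖v‖ = 1) :
    ∃ α : ℝ, v 0 = Real.cos α ∧ v 1 = Real.sin α := by
  have h : v 0 ^ 2 + v 1 ^ 2 = 1 := by
    have := EuclideanSpace.norm_sq_eq v
    rw [hv] at this
    simpa using this.symm
  have hn : ‖(⟨v 0, v 1⟩ : ℂ)‖ = 1 := by
    rw [← sq_eq_sq₀ (norm_nonneg _) zero_le_one, ← Complex.normSq_eq_norm_sq, Complex.normSq_apply]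
    linarith
  refine ⟨Complex.arg ⟨v 0, v 1⟩, ?_, ?_⟩
  · rw [Complex.cos_arg (norm_ne_zero_iff.1 (by rw [hn]; exact one_ne_zero)), hn, div_one]
  · rw [Complex.sin_arg, hn, div_one]

theorem isWeakAngularDeriv_deriv {F : ℝ → ℝ} (hF : ContDiff ℝ 1 F)
    (hper : Function.Periodic F (2 * Real.pi)) : IsWeakAngularDeriv F (deriv F) := by
  have hle : (0 : ℝ) ≤ 2 * Real.pi := by positivity
  have hon : ∀ {f : ℝ → ℝ}, Continuous f → IntegrableOn f (Ioo 0 (2 * Real.pi)) := fun hf =>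
    (hf.integrableOn_Icc (a := 0) (b := 2 * Real.pi)).mono_set Ioo_subset_Icc_self
  refine ⟨hon hF.continuous, hon hF.continuous_deriv_one, fun φ hφ hφper => ?_⟩
  have hφ1 : ContDiff ℝ 1 φ := hφ.of_le (by exact_mod_cast le_top)
  have hparts := intervalIntegral.integral_mul_deriv_eq_deriv_mul (a := 0) (b := 2 * Real.pi)
    (fun θ _ => (hF.differentiable one_ne_zero θ).hasDerivAt)
    (fun θ _ => (hφ1.differentiable one_ne_zero θ).hasDerivAt)
    (hF.continuous_deriv_one.intervalIntegrable _ _)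
    (hφ1.continuous_deriv_one.intervalIntegrable _ _)
  rw [← integral_Ioc_eq_integral_Ioo, ← integral_Ioc_eq_integral_Ioo,
    ← intervalIntegral.integral_of_le hle, ← intervalIntegral.integral_of_le hle, hparts,
    hper.eq, hφper.eq]
  ring

/-- The classical derivative is a competitor in the infimum. The term `2π` bounds the `L¹` norm
since `|ψ| ≤ 1`, and periodicity removes the rotation by `α` from the variation. -/
theorem sobolevOneOneNorm_le_of_onCircle_eq {ψ : ℝ → ℝ} (hψ : ContDiff ℝ 1 ψ)
    (hψ_bdd : ∀ z, |ψ z| ≤ 1) (hint : Integrable fun z => |deriv ψ z|) {δ : ℝ} (hδ : 0 < δ)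
    {f : Plane → ℝ} {α : ℝ} (hf : onCircle f = fun θ => ψ (Real.cos (θ - α) / δ)) :
    sobolevOneOneNorm f ≤ ENNReal.ofReal (2 * Real.pi + 2 * ∫ z, |deriv ψ z|) := by
  have hle : (0 : ℝ) ≤ 2 * Real.pi := by positivity
  have hC : ContDiff ℝ 1 (onCircle f) := by
    rw [hf]
    exact hψ.comp ((Real.contDiff_cos.comp (contDiff_id.sub contDiff_const)).div_const δ)
  have hper : Function.Periodic (onCircle f) (2 * Real.pi) := fun θ => by
    simp only [hf]
    rw [add_sub_right_comm, Real.cos_add_two_pi]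
  let h : ℝ → ℝ := fun θ => |deriv ψ (Real.cos θ / δ) * (-Real.sin θ / δ)|
  have hderiv : ∀ θ, |deriv (onCircle f) θ| = h (θ - α) := fun θ => by
    have h1 : HasDerivAt (fun θ => Real.cos (θ - α) / δ) (-Real.sin (θ - α) / δ) θ := by
      have := ((Real.hasDerivAt_cos (θ - α)).comp_sub_const θ α).div_const δ
      exact this
    have h2 : HasDerivAt (fun θ => ψ (Real.cos (θ - α) / δ)) _ θ :=
      (hψ.differentiable one_ne_zero _).hasDerivAt.comp θ h1
    rw [hf, h2.deriv]
  have hhper : Function.Periodic h (2 * Real.pi) := fun θ => by simp [h]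
  have hshift : ∫ θ in 0..2 * Real.pi, h (θ - α) = ∫ θ in 0..2 * Real.pi, h θ := by
    rw [intervalIntegral.integral_comp_sub_right, zero_sub, sub_eq_neg_add,
      hhper.intervalIntegral_add_eq (-α) 0, zero_add]
  have hlin : ∀ {g : ℝ → ℝ}, Continuous g → ∫⁻ θ in Ioo 0 (2 * Real.pi), ‖g θ‖ₑ =
      ENNReal.ofReal (∫ θ in 0..2 * Real.pi, |g θ|) := fun {g} hg => by
    have hgi : IntegrableOn g (Ioo 0 (2 * Real.pi)) :=
      (hg.integrableOn_Icc (a := 0) (b := 2 * Real.pi)).mono_set Ioo_subset_Icc_self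
    rw [intervalIntegral.integral_of_le hle, integral_Ioc_eq_integral_Ioo]
    exact (ofReal_integral_norm_eq_lintegral_enorm hgi).symm
  unfold sobolevOneOneNorm
  refine (iInf₂_le (deriv (onCircle f)) (isWeakAngularDeriv_deriv hC hper)).trans ?_
  have hV : 0 ≤ ∫ z, |deriv ψ z| := integral_nonneg fun z => abs_nonneg _
  rw [hlin hC.continuous, hlin hC.continuous_deriv_one, ENNReal.ofReal_add hle (by positivity)]
  gcongr
  · calc ∫ θ in 0..2 * Real.pi, |onCircle f θ| ≤ ∫ θ in 0..2 * Real.pi, (1 : ℝ) :=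
          intervalIntegral.integral_mono_on hle (hC.continuous.abs.intervalIntegrable _ _)
            intervalIntegrable_const fun θ _ => by rw [hf]; exact hψ_bdd _
      _ = 2 * Real.pi := by simp
  · simp_rw [hderiv]
    rw [hshift]
    exact integral_abs_deriv_comp_cos_le hψ hint δ hδ

/-- Here `α` is the polar angle of `u x`, and the inner product of two unit vectors is the cosine of
the difference of their angles. -/
theorem onCircle_smoothedSymbol (ψ : ℝ → ℝ) {u : Plane → Plane} (δ : ℝ) {x : Plane}
    (hu : ‖u x‖ = 1) : ∃ α : ℝ, onCircle (smoothedSymbol ψ u δ x) =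
      fun θ => ψ (Real.cos (θ - α) / δ) := by
  obtain ⟨α, h0, h1⟩ := exists_eq_cos_sin hu
  refine ⟨α, funext fun θ => ?_⟩
  have hn : ‖(!₂[Real.cos θ, Real.sin θ] : Plane)‖ = 1 := by
    rw [EuclideanSpace.norm_eq]
    simp
  simp only [onCircle, smoothedSymbol, hn, inv_one, one_smul, Real.cos_sub]
  congr 2
  simp [PiLp.inner_apply, Fin.sum_univ_two, h0, h1]

theorem mainTheorem5 (ψ : ℝ → ℝ) (hψ : ContDiff ℝ ∞ ψ) (hψ_bdd : ∀ z, |ψ z| ≤ 1)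
    (hψ_neg : ∀ z, z ≤ -1 → ψ z = -1) (hψ_pos : ∀ z, 1 ≤ z → ψ z = 1) :
    ∃ C : ℝ≥0, ∀ N : ℝ, 1 < N → ∃ σ : Plane → Plane → ℝ,
      Measurable (Function.uncurry σ) ∧
      HomogeneousDegreeZero σ ∧
      IsSmoothedDirectionalHilbert ψ σ ∧
      (∀ x ξ, |σ x ξ| ≤ 1) ∧
      (⨆ x, sobolevOneOneNorm (σ x)) ≤ C ∧
      ENNReal.ofReal N < pdoNorm σ := by
  have hψ1 : ContDiff ℝ 1 ψ := hψ.of_le (by exact_mod_cast le_top)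
  have hint := integrable_abs_deriv_of_eq_const hψ1 hψ_neg hψ_pos
  refine ⟨Real.toNNReal (2 * Real.pi + 2 * ∫ z, |deriv ψ z|), fun N _ => ?_⟩
  obtain ⟨δ, hδ0, hδ1, hδ⟩ :=
    exists_lt_pdoNorm_smoothedSymbol hψ.continuous hψ_bdd hψ_neg hψ_pos N
  refine ⟨smoothedSymbol ψ radialField δ,
    measurable_uncurry_smoothedSymbol hψ.continuous.measurable measurable_radialField δ,
    homogeneousDegreeZero_smoothedSymbol ψ radialField δ,
    ⟨radialField, δ, measurable_radialField, norm_radialField, hδ0, hδ1, fun _ _ _ => rfl⟩,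
    fun _ _ => hψ_bdd _, iSup_le fun x => ?_, hδ⟩
  obtain ⟨α, hα⟩ := onCircle_smoothedSymbol ψ δ (norm_radialField x)
  exact sobolevOneOneNorm_le_of_onCircle_eq hψ1 hψ_bdd hint hδ0 hα
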